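/- Consider the algebraic language with binary operations $\land,\lor,\otimes,\oplus$ and a unary operation $\neg$; algebras of this language are not required to satisfy any identities. Let $Fm$ be the algebra of formulas, i.e. the free algebra over a countably infinite set of variables. Let $\mathcal{FOUR}$ be the algebra on $\{\mathsf f,\bot,\top,\mathsf t\}$ in which $\land,\lor$ are the meet and join of the lattice with minimum $\mathsf f$, maximum $\mathsf t$ and $\bot,\top$ incomparable, $\otimes,\oplus$ are the meet and join of the lattice with minimum $\bot$, maximum $\top$ and $\mathsf f,\mathsf t$ incomparable, and $\neg$ exchanges $\mathsf f$ and $\mathsf t$ and fixes $\bot$ and $\top$. The logic $\mathcal{LB}$ is defined by: $\Gamma\vDash_{\mathcal{LB}}\varphi$ iff for every homomorphism $h:Fm\to\mathcal{FOUR}$, $h[\Gamma]\subseteq\{\top,\mathsf t\}$ implies $h(\varphi)\in\{\top,\mathsf t\}$. For a logic $\mathcal L$, i.e. a substitution-invariant closure operator on $Fm$ with consequence relation $\vdash_{\mathcal L}$, a subset $F$ of an algebra $A$ is an $\mathcal L$-filter if $\Gamma\vdash_{\mathcal L}\varphi$ and $h[\Gamma]\subseteq F$ imply $h(\varphi)\in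 F$, for all $\Gamma\cup\{\varphi\}\subseteq Fm$ and all homomorphisms $h:Fm\to A$; $\mathcal Fi_{\mathcal L}A$ is the family of all $\mathcal L$-filters on $A$. An abstract logic $\langle A,\mathbf C\rangle$ is an algebra $A$ with a closure operator $\mathbf C$ on its universe. It is finitary if $a\in\mathbf C(X)$ implies $a\in\mathbf C(Y)$ for some finite $Y\subseteq X$, and it is a full model of $\mathcal L$ if there are an algebra $B$ and a surjective homomorphism $h:A\to B$ such that the $\mathbf C$-closed sets are exactly the sets $h^{-1}[T]$ with $T\in\mathcal Fi_{\mathcal L}B$. (1) An abstract logic $\langle A,\mathbf C\rangle$ is a full model of $\mathcal{LB}$ if and only if it is finitary and satisfies, for all $a,b\in A$ and all $X\subseteq A$: (E) $\mathbf C(\emptyset)=\emptyset$; (PC) $\mathbf C(a\land b)=\mathbf C(a\otimes b)=\mathbf C(a,b)$; (PDI) $\mathbf C(X,a\lor b)=\mathbf C(X,a\oplus b)=\mathbf C(X,a)\cap\mathbf C(X,b)$; (PDN) $\mathbf C(a)=\mathbf C(\neg\neg a)$; (PDM) $\mathbf C(\neg(a\land b))=\mathbf C(\neg a\lor\neg b)$,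 $\mathbf C(\neg(a\lor b))=\mathbf C(\neg a\land\neg b)$, $\mathbf C(\neg(a\otimes b))=\mathbf C(\neg a\otimes\neg b)$ and $\mathbf C(\neg(a\oplus b))=\mathbf C(\neg a\oplus\neg b)$. (2) A sequent $\Gamma\rhd\Delta$ is a pair of finite non-empty sets of formulas. Let $\mathcal{G_{LB}}$ be the sequent calculus with the axiom $\Gamma,\varphi\rhd\varphi,\Delta$, the cut rule (from $\Gamma_1\rhd\Delta_1,\varphi$ and $\Gamma_2,\varphi\rhd\Delta_2$ infer $\Gamma_1,\Gamma_2\rhd\Delta_1,\Delta_2$) and the following rules. For $\circ\in\{\land,\otimes\}$: from $\Gamma,\varphi,\psi\rhd\Delta$ infer $\Gamma,\varphi\circ\psi\rhd\Delta$; from $\Gamma\rhd\Delta,\varphi$ and $\Gamma\rhd\Delta,\psi$ infer $\Gamma\rhd\Delta,\varphi\circ\psi$. For $\bullet\in\{\lor,\oplus\}$: from $\Gamma,\varphi\rhd\Delta$ and $\Gamma,\psi\rhd\Delta$ infer $\Gamma,\varphi\bullet\psi\rhd\Delta$; from $\Gamma\rhd\Delta,\varphi,\psi$ infer $\Gamma\rhd\Delta,\varphi\bullet\psi$.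 For $\circ\in\{\lor,\otimes\}$: from $\Gamma,\neg\varphi,\neg\psi\rhd\Delta$ infer $\Gamma,\neg(\varphi\circ\psi)\rhd\Delta$; from $\Gamma\rhd\Delta,\neg\varphi$ and $\Gamma\rhd\Delta,\neg\psi$ infer $\Gamma\rhd\Delta,\neg(\varphi\circ\psi)$. For $\bullet\in\{\land,\oplus\}$: from $\Gamma,\neg\varphi\rhd\Delta$ and $\Gamma,\neg\psi\rhd\Delta$ infer $\Gamma,\neg(\varphi\bullet\psi)\rhd\Delta$; from $\Gamma\rhd\Delta,\neg\varphi,\neg\psi$ infer $\Gamma\rhd\Delta,\neg(\varphi\bullet\psi)$. Finally, from $\Gamma,\varphi\rhd\Delta$ infer $\Gamma,\neg\neg\varphi\rhd\Delta$; from $\Gamma\rhd\Delta,\varphi$ infer $\Gamma\rhd\Delta,\neg\neg\varphi$. (The contexts in axiom and rules may be empty, as long as the sequents have non-empty sides.) An abstract logic $\langle A,\mathbf C\rangle$ is a model of $\mathcal{G_{LB}}$ if, whenever a sequent $\Gamma\rhd\varphi$ is derivable in $\mathcal{G_{LB}}$ from a family of sequents $\{\Gamma_i\rhd\varphi_i:i\in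 I\}$ and $h:Fm\to A$ is a homomorphism with $h(\varphi_i)\in\mathbf C(h[\Gamma_i])$ for all $i\in I$, also $h(\varphi)\in\mathbf C(h[\Gamma])$. Then $\mathcal{G_{LB}}$ is fully adequate for $\mathcal{LB}$: an abstract logic $\langle A,\mathbf C\rangle$ is a full model of $\mathcal{LB}$ if and only if it is finitary, is a model of $\mathcal{G_{LB}}$, and has theorems ($\mathbf C(\emptyset)\neq\emptyset$) if $\mathcal{LB}$ has theorems, and no theorems ($\mathbf C(\emptyset)=\emptyset$) if $\mathcal{LB}$ has none. -/

import Mathlib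

universe u v

namespace LogBilat

/-- Algebras of the bilattice language: binary operations `∧` (`tInf`), `∨` (`tSup`), `⊗` (`kInf`),
`⊕` (`kSup`) and a unary operation `¬` (`neg`), not subject to any identity. -/
class Alg (A : Type u) where
  tInf : A → A → A
  tSup : A → A → A
  kInf : A → A → A
  kSup : A → A → A
  neg : A → A

open Alg

/-- Homomorphisms of algebras of the bilattice language. -/
structure Hom (A : Type u) (B : Type v) [Alg A] [Alg B] where
  toFun : A → B
  map_tInf : ∀ a b, toFun (tInf a b) = tInf (toFun a) (toFun b)
  map_tSup : ∀ a b, toFun (tSup a b) = tSup (toFun a) (toFun b)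
  map_kInf : ∀ a b, toFun (kInf a b) = kInf (toFun a) (toFun b)
  map_kSup : ∀ a b, toFun (kSup a b) = kSup (toFun a) (toFun b)
  map_neg : ∀ a, toFun (neg a) = neg (toFun a)

instance {A : Type u} {B : Type v} [Alg A] [Alg B] : CoeFun (Hom A B) (fun _ => A → B) :=
  ⟨Hom.toFun⟩

/-- Composition of homomorphisms. -/
def Hom.comp {A : Type*} {B : Type*} {D : Type*} [Alg A] [Alg B] [Alg D]
    (g : Hom B D) (f : Hom A B) : Hom A D where
  toFun a := g (f a)
  map_tInf a b := by rw [f.map_tInf, g.map_tInf]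
  map_tSup a b := by rw [f.map_tSup, g.map_tSup]
  map_kInf a b := by rw [f.map_kInf, g.map_kInf]
  map_kSup a b := by rw [f.map_kSup, g.map_kSup]
  map_neg a := by rw [f.map_neg, g.map_neg]

/-! Formulas -/

/-- Formulas: the free algebra of the bilattice language (without constants) over the countably
infinite set of variables `var 0, var 1, …`. -/
inductive Fm : Type
  | var (n : ℕ) : Fm
  | tInf (φ ψ : Fm) : Fm
  | tSup (φ ψ : Fm) : Fm
  | kInf (φ ψ : Fm) : Fm
  | kSup (φ ψ : Fm) : Fm
  | neg (φ : Fm) : Fm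
  deriving DecidableEq

instance : Alg Fm where
  tInf := Fm.tInf
  tSup := Fm.tSup
  kInf := Fm.kInf
  kSup := Fm.kSup
  neg := Fm.neg

/-! Sentential logics -/

/-- A sentential logic: a closure operator on the set of formulas that is structural, that is,
invariant under substitutions (endomorphisms of the formula algebra). -/
structure Logic where
  C : ClosureOperator (Set Fm)
  structural : ∀ (σ : Hom Fm Fm) (Γ : Set Fm) (φ : Fm), φ ∈ C Γ → σ φ ∈ C (σ '' Γ)

/-- The consequence relation `Γ ⊢ φ` of a logic. -/
def Logic.Entails (L : Logic) (Γ : Set Fm) (φ : Fm) : Prop := φ ∈ L.C Γ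

/-- A logic has theorems when some formula follows from the empty set. -/
def Logic.HasTheorems (L : Logic) : Prop := ∃ φ, L.Entails ∅ φ

/-- Consequence in the matrix `⟨M, D⟩`: every valuation that designates all of `Γ`
designates `φ`. -/
def MatrixEntails (M : Type u) [Alg M] (D : Set M) (Γ : Set Fm) (φ : Fm) : Prop :=
  ∀ h : Hom Fm M, (∀ γ ∈ Γ, h γ ∈ D) → h φ ∈ D

/-- The logic defined by the matrix `⟨M, D⟩`. -/
def matrixLogic (M : Type u) [Alg M] (D : Set M) : Logic where
  C := ClosureOperator.mk' (fun Γ => {φ | MatrixEntails M D Γ φ})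
    (fun _ _ hΓΔ _ hφ h hΔ => hφ h fun γ hγ => hΔ γ (hΓΔ hγ))
    (fun _ φ hφ _ hΓ => hΓ φ hφ)
    (fun _ _ hφ h hΓ => hφ h fun _ hγ => hγ h hΓ)
  structural := by
    intro σ Γ φ hφ h hΓ
    exact hφ (h.comp σ) fun γ hγ => hΓ (σ γ) ⟨γ, hγ, rfl⟩

/-! The bilattice FOUR and the logic LB -/

/-- The four elements `f`, `⊥`, `⊤`, `t`. -/
inductive Four : Type
  | f | bot | top | t
  deriving DecidableEq

/-- The bilattice FOUR. In the truth order, `f` is the minimum, `t` the maximum and `⊥`, `⊤` are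
incomparable; in the knowledge order, `⊥` is the minimum, `⊤` the maximum and `f`, `t` are
incomparable. Negation exchanges `f` and `t`. -/
instance : Alg Four where
  tInf
    | .f, _ => .f
    | .t, y => y
    | _, .f => .f
    | x, .t => x
    | .bot, .bot => .bot
    | .top, .top => .top
    | .bot, .top => .f
    | .top, .bot => .f
  tSup
    | .t, _ => .t
    | .f, y => y
    | _, .t => .t
    | x, .f => x
    | .bot, .bot => .bot
    | .top, .top => .top
    | .bot, .top => .t
    | .top, .bot => .t
  kInf
    | .bot, _ => .bot
    | .top, y => y
    | _, .bot => .bot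
    | x, .top => x
    | .f, .f => .f
    | .t, .t => .t
    | .f, .t => .bot
    | .t, .f => .bot
  kSup
    | .top, _ => .top
    | .bot, y => y
    | _, .top => .top
    | x, .bot => x
    | .f, .f => .f
    | .t, .t => .t
    | .f, .t => .top
    | .t, .f => .top
  neg
    | .f => .t
    | .t => .f
    | .bot => .bot
    | .top => .top

/-- The designated elements of FOUR. -/
def Tr : Set Four := {Four.top, Four.t}

/-- The logic of logical bilattices: the logic defined by the matrix `⟨FOUR, Tr⟩`. -/
def LB : Logic := matrixLogic Four Tr

/-! Filters, abstract logics and full models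

An abstract logic is an algebra `A` with a closure operator `C` on `A`; the equivalent g-matrix is
`A` with the closure system of the `C`-closed sets. -/

/-- The family of all `L`-filters on `A`: the sets `F` such that `⟨A, F⟩` is a matrix model
of `L`. -/
def Fi (L : Logic) (A : Type u) [Alg A] : Set (Set A) :=
  {F | ∀ (Γ : Set Fm) (φ : Fm), L.Entails Γ φ → MatrixEntails A F Γ φ}

/-- The closure system of a closure operator. -/
def closureSystem {A : Type u} (C : ClosureOperator (Set A)) : Set (Set A) :=
  {T | C.IsClosed T}

/-- `h` is a bilogical morphism from `⟨A, 𝒞⟩` to `⟨B, 𝒟⟩`: an epimorphism such that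
`𝒞 = {h⁻¹[T] : T ∈ 𝒟}`. -/
def IsBilogicalMorphism {A : Type u} {B : Type v} [Alg A] [Alg B]
    (𝒞 : Set (Set A)) (𝒟 : Set (Set B)) (h : Hom A B) : Prop :=
  Function.Surjective h ∧ 𝒞 = {X | ∃ T ∈ 𝒟, X = h ⁻¹' T}

/-- `⟨A, C⟩` is a full model of `L`: there is a bilogical morphism from it to some `⟨B, Fi L B⟩`.
Since `B` is a homomorphic image of `A`, nothing is lost by taking it in the universe of `A`. -/
def IsFullModel (L : Logic) {A : Type u} [Alg A] (C : ClosureOperator (Set A)) : Prop :=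
  ∃ (B : Type u) (_ : Alg B) (h : Hom A B), IsBilogicalMorphism (closureSystem C) (Fi L B) h

/-- `C` is finitary. -/
def Finitary {A : Type u} (C : ClosureOperator (Set A)) : Prop :=
  ∀ (X : Set A) (a : A), a ∈ C X → ∃ Y : Set A, Y.Finite ∧ Y ⊆ X ∧ a ∈ C Y

/-! Tarski-style conditions on an abstract logic -/

/-- (E) -/
def PropE {A : Type u} (C : ClosureOperator (Set A)) : Prop := C ∅ = ∅

/-- (PC) -/
def PropPC {A : Type u} [Alg A] (C : ClosureOperator (Set A)) : Prop :=
  ∀ a b : A, C {tInf a b} = C {kInf a b} ∧ C {kInf a b} = C {a, b}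

/-- (PDI) -/
def PropPDI {A : Type u} [Alg A] (C : ClosureOperator (Set A)) : Prop :=
  ∀ (X : Set A) (a b : A),
    C (X ∪ {tSup a b}) = C (X ∪ {kSup a b}) ∧
    C (X ∪ {kSup a b}) = C (X ∪ {a}) ∩ C (X ∪ {b})

/-- (PDN) -/
def PropPDN {A : Type u} [Alg A] (C : ClosureOperator (Set A)) : Prop :=
  ∀ a : A, C {a} = C {neg (neg a)}

/-- (PDM) -/
def PropPDM {A : Type u} [Alg A] (C : ClosureOperator (Set A)) : Prop :=
  ∀ a b : A,
    C {neg (tInf a b)} = C {tSup (neg a) (neg b)} ∧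
    C {neg (tSup a b)} = C {tInf (neg a) (neg b)} ∧
    C {neg (kInf a b)} = C {kInf (neg a) (neg b)} ∧
    C {neg (kSup a b)} = C {kSup (neg a) (neg b)}

/-! Sequents, Gentzen systems and the calculus `G_LB` -/

/-- Sequents `Γ ▷ Δ`: pairs of finite non-empty sets of formulas. -/
structure Sequent where
  ant : Finset Fm
  suc : Finset Fm
  ant_nonempty : ant.Nonempty
  suc_nonempty : suc.Nonempty

/-- A sequent `Γ ▷ φ` with one formula on the right. -/
def Sequent.single (Γ : Finset Fm) (hΓ : Γ.Nonempty) (φ : Fm) : Sequent where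
  ant := Γ
  suc := {φ}
  ant_nonempty := hΓ
  suc_nonempty := Finset.singleton_nonempty φ

/-- `Derivable H Γ Δ`: the sequent `Γ ▷ Δ` has a derivation from the sequents in `H` by the axiom
and the rules of `G_LB`. The contexts `Γ`, `Δ` in a rule may be empty, but every sequent that
occurs in a derivation has two non-empty sides (see `Derivable.nonempty`). -/
inductive Derivable (H : Set Sequent) : Finset Fm → Finset Fm → Prop
  | hyp (S : Sequent) : S ∈ H → Derivable H S.ant S.suc
  | ax (Γ Δ : Finset Fm) (φ : Fm) : Derivable H (insert φ Γ) (insert φ Δ)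
  | cut (Γ₁ Δ₁ Γ₂ Δ₂ : Finset Fm) (φ : Fm) :
      Derivable H Γ₁ (insert φ Δ₁) → Derivable H (insert φ Γ₂) Δ₂ →
      Derivable H (Γ₁ ∪ Γ₂) (Δ₁ ∪ Δ₂)
  | tInf_left (Γ Δ : Finset Fm) (φ ψ : Fm) :
      Derivable H (insert φ (insert ψ Γ)) Δ → Derivable H (insert (.tInf φ ψ) Γ) Δ
  | tInf_right (Γ Δ : Finset Fm) (φ ψ : Fm) :
      Derivable H Γ (insert φ Δ) → Derivable H Γ (insert ψ Δ) →
      Derivable H Γ (insert (.tInf φ ψ) Δ)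
  | neg_tInf_left (Γ Δ : Finset Fm) (φ ψ : Fm) :
      Derivable H (insert (.neg φ) Γ) Δ → Derivable H (insert (.neg ψ) Γ) Δ →
      Derivable H (insert (.neg (.tInf φ ψ)) Γ) Δ
  | neg_tInf_right (Γ Δ : Finset Fm) (φ ψ : Fm) :
      Derivable H Γ (insert (.neg φ) (insert (.neg ψ) Δ)) →
      Derivable H Γ (insert (.neg (.tInf φ ψ)) Δ)
  | tSup_left (Γ Δ : Finset Fm) (φ ψ : Fm) :
      Derivable H (insert φ Γ) Δ → Derivable H (insert ψ Γ) Δ →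
      Derivable H (insert (.tSup φ ψ) Γ) Δ
  | tSup_right (Γ Δ : Finset Fm) (φ ψ : Fm) :
      Derivable H Γ (insert φ (insert ψ Δ)) → Derivable H Γ (insert (.tSup φ ψ) Δ)
  | neg_tSup_left (Γ Δ : Finset Fm) (φ ψ : Fm) :
      Derivable H (insert (.neg φ) (insert (.neg ψ) Γ)) Δ →
      Derivable H (insert (.neg (.tSup φ ψ)) Γ) Δ
  | neg_tSup_right (Γ Δ : Finset Fm) (φ ψ : Fm) :
      Derivable H Γ (insert (.neg φ) Δ) → Derivable H Γ (insert (.neg ψ) Δ) →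
      Derivable H Γ (insert (.neg (.tSup φ ψ)) Δ)
  | kInf_left (Γ Δ : Finset Fm) (φ ψ : Fm) :
      Derivable H (insert φ (insert ψ Γ)) Δ → Derivable H (insert (.kInf φ ψ) Γ) Δ
  | kInf_right (Γ Δ : Finset Fm) (φ ψ : Fm) :
      Derivable H Γ (insert φ Δ) → Derivable H Γ (insert ψ Δ) →
      Derivable H Γ (insert (.kInf φ ψ) Δ)
  | neg_kInf_left (Γ Δ : Finset Fm) (φ ψ : Fm) :
      Derivable H (insert (.neg φ) (insert (.neg ψ) Γ)) Δ →
      Derivable H (insert (.neg (.kInf φ ψ)) Γ) Δ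
  | neg_kInf_right (Γ Δ : Finset Fm) (φ ψ : Fm) :
      Derivable H Γ (insert (.neg φ) Δ) → Derivable H Γ (insert (.neg ψ) Δ) →
      Derivable H Γ (insert (.neg (.kInf φ ψ)) Δ)
  | kSup_left (Γ Δ : Finset Fm) (φ ψ : Fm) :
      Derivable H (insert φ Γ) Δ → Derivable H (insert ψ Γ) Δ →
      Derivable H (insert (.kSup φ ψ) Γ) Δ
  | kSup_right (Γ Δ : Finset Fm) (φ ψ : Fm) :
      Derivable H Γ (insert φ (insert ψ Δ)) → Derivable H Γ (insert (.kSup φ ψ) Δ)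
  | neg_kSup_left (Γ Δ : Finset Fm) (φ ψ : Fm) :
      Derivable H (insert (.neg φ) Γ) Δ → Derivable H (insert (.neg ψ) Γ) Δ →
      Derivable H (insert (.neg (.kSup φ ψ)) Γ) Δ
  | neg_kSup_right (Γ Δ : Finset Fm) (φ ψ : Fm) :
      Derivable H Γ (insert (.neg φ) (insert (.neg ψ) Δ)) →
      Derivable H Γ (insert (.neg (.kSup φ ψ)) Δ)
  | neg_neg_left (Γ Δ : Finset Fm) (φ : Fm) :
      Derivable H (insert φ Γ) Δ → Derivable H (insert (.neg (.neg φ)) Γ) Δ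
  | neg_neg_right (Γ Δ : Finset Fm) (φ : Fm) :
      Derivable H Γ (insert φ Δ) → Derivable H Γ (insert (.neg (.neg φ)) Δ)

theorem Derivable.nonempty {H : Set Sequent} {Γ Δ : Finset Fm} (h : Derivable H Γ Δ) :
    Γ.Nonempty ∧ Δ.Nonempty := by
  induction h with
  | hyp S _ => exact ⟨S.ant_nonempty, S.suc_nonempty⟩
  | cut Γ₁ Δ₁ Γ₂ Δ₂ φ _ _ ih₁ ih₂ =>
    exact ⟨ih₁.1.mono Finset.subset_union_left, ih₂.2.mono Finset.subset_union_right⟩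
  | _ => simp_all

/-- A Gentzen system, given by its consequence relation between sets of sequents and sequents. -/
abbrev GentzenSystem := Set Sequent → Sequent → Prop

/-- The Gentzen system `G_LB`: derivability of a sequent from a set of sequents. -/
def GLB : GentzenSystem := fun H S => Derivable H S.ant S.suc

/-- The abstract logic `⟨A, C⟩` is a model of the Gentzen system `G`. There are only countably many
sequents, so index types in `Type` give all families of sequents. -/
def IsGentzenModel (G : GentzenSystem) {A : Type u} [Alg A] (C : ClosureOperator (Set A)) : Prop :=
  ∀ (I : Type) (Γ : I → Finset Fm) (hΓ : ∀ i, (Γ i).Nonempty) (φ : I → Fm)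
    (Γ₀ : Finset Fm) (hΓ₀ : Γ₀.Nonempty) (φ₀ : Fm),
    G (Set.range fun i => Sequent.single (Γ i) (hΓ i) (φ i)) (Sequent.single Γ₀ hΓ₀ φ₀) →
    ∀ h : Hom Fm A, (∀ i, h (φ i) ∈ C (h '' (Γ i : Set Fm))) →
      h φ₀ ∈ C (h '' (Γ₀ : Set Fm))

/-- The Gentzen system `G` is fully adequate for the logic `L`: the full models of `L` are exactly
the finitary models of `G` with theorems, if `L` has theorems, and exactly the finitary models of
`G` without theorems otherwise. -/
def FullyAdequate (G : GentzenSystem) (L : Logic) : Prop :=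
  ∀ (A : Type u) [Alg A] (C : ClosureOperator (Set A)),
    IsFullModel L C ↔
      Finitary C ∧ IsGentzenModel G C ∧
        (L.HasTheorems → (C ∅).Nonempty) ∧ (¬ L.HasTheorems → C ∅ = ∅)

end LogBilat

namespace LogBilat

open Alg

variable {A : Type u} {B : Type v} [Alg A] [Alg B]

/-! The proof rests on prime bifilters (`IsBiprime`). An element of FOUR is determined by whether it
and its negation are designated, so prime bifilters are exactly the inverse images of `Tr` under
homomorphisms to FOUR, and in particular they are filters of LB.

Under the Tarski-style conditions, a closed set maximal among those omitting a given point is prime,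
by (PDI). Zorn's lemma, with finitarity, then makes every closed set an intersection of closed prime
bifilters, hence an LB-filter. To get a full model, identify elements that have the same closure and
whose negations have the same closure. It remains to see that filters of the quotient pull back to
closed sets. By (E), (PC) and finitarity this reduces to one generator: if `a ∈ T` and `c ∈ C {a}`,
then `a ⊕ c` lies in `T` and is identified with `c ∧ (c ⊕ a)`, so `c ∈ T`. The negations match
because (PDM) turns both `¬(x ∧ y)` and `¬(x ⊕ y)` into disjunctions of `¬x` and `¬y`.

Conversely, in a full model closure is filter generation. Finitarity comes from compactness of the
space of valuations in FOUR, and (PDI) from the fact that `{c | c ∨ b ∈ T}` is a filter whenever `T`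
is.

For the calculus, every rule preserves truth in prime bifilters, so separation by closed prime
bifilters yields Gentzen models. In the other direction the conditions are read off short
derivations, except that (E) comes from LB having no theorems and (PDI) also needs finitarity,
because contexts are finite. -/

/-! Prime bifilters -/

/-- The sets of designated elements of homomorphisms to `Four`. -/
structure IsBiprime (P : Set A) : Prop where
  tInf : ∀ a b, tInf a b ∈ P ↔ a ∈ P ∧ b ∈ P
  tSup : ∀ a b, tSup a b ∈ P ↔ a ∈ P ∨ b ∈ P
  kInf : ∀ a b, kInf a b ∈ P ↔ a ∈ P ∧ b ∈ P
  kSup : ∀ a b, kSup a b ∈ P ↔ a ∈ P ∨ b ∈ P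
  neg_tInf : ∀ a b, neg (Alg.tInf a b) ∈ P ↔ neg a ∈ P ∨ neg b ∈ P
  neg_tSup : ∀ a b, neg (Alg.tSup a b) ∈ P ↔ neg a ∈ P ∧ neg b ∈ P
  neg_kInf : ∀ a b, neg (Alg.kInf a b) ∈ P ↔ neg a ∈ P ∧ neg b ∈ P
  neg_kSup : ∀ a b, neg (Alg.kSup a b) ∈ P ↔ neg a ∈ P ∨ neg b ∈ P
  neg_neg : ∀ a, neg (neg a) ∈ P ↔ a ∈ P

theorem isBiprime_Tr : IsBiprime Tr := by
  constructor <;> intro a <;> cases a <;> try (intro b; cases b)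
  all_goals simp [Tr, Alg.tInf, Alg.tSup, Alg.kInf, Alg.kSup, Alg.neg]

theorem IsBiprime.preimage {P : Set B} (hP : IsBiprime P) (h : Hom A B) :
    IsBiprime (h ⁻¹' P) := by
  constructor <;> intros <;>
    simp only [Set.mem_preimage, h.map_tInf, h.map_tSup, h.map_kInf, h.map_kSup, h.map_neg,
      hP.tInf, hP.tSup, hP.kInf, hP.kSup, hP.neg_tInf, hP.neg_tSup, hP.neg_kInf, hP.neg_kSup,
      hP.neg_neg]

/-- Elements of `Four` are determined by whether they and their negations are designated. -/
theorem Four.eq_of_mem_Tr_iff {x y : Four} (h : x ∈ Tr ↔ y ∈ Tr)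
    (hn : Alg.neg x ∈ Tr ↔ Alg.neg y ∈ Tr) : x = y := by
  revert h hn
  cases x <;> cases y <;> simp [Tr, Alg.neg]

theorem Four.exists_mem_Tr_iff (p q : Prop) : ∃ x : Four, (x ∈ Tr ↔ p) ∧ (Alg.neg x ∈ Tr ↔ q) := by
  by_cases hp : p <;> by_cases hq : q
  · exact ⟨.top, by simp [Tr, Alg.neg, hp, hq]⟩
  · exact ⟨.t, by simp [Tr, Alg.neg, hp, hq]⟩
  · exact ⟨.f, by simp [Tr, Alg.neg, hp, hq]⟩
  · exact ⟨.bot, by simp [Tr, Alg.neg, hp, hq]⟩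

/-- The truth values of `a ∈ P` and `neg a ∈ P` serve as coordinates of the image of `a` in FOUR.
The clauses of `IsBiprime` are the operations of FOUR in these coordinates. -/
theorem IsBiprime.exists_hom {P : Set A} (hP : IsBiprime P) :
    ∃ v : Hom A Four, ∀ a, v a ∈ Tr ↔ a ∈ P := by
  choose v hv hn using fun a => Four.exists_mem_Tr_iff (a ∈ P) (Alg.neg a ∈ P)
  have hT := isBiprime_Tr
  refine ⟨⟨v, ?_, ?_, ?_, ?_, ?_⟩, hv⟩ <;> intros <;> apply Four.eq_of_mem_Tr_iff <;>
    simp only [hv, hn, hT.tInf, hT.tSup, hT.kInf, hT.kSup, hT.neg_tInf, hT.neg_tSup, hT.neg_kInf,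
      hT.neg_kSup, hT.neg_neg, hP.tInf, hP.tSup, hP.kInf, hP.kSup, hP.neg_tInf, hP.neg_tSup,
      hP.neg_kInf, hP.neg_kSup, hP.neg_neg]

theorem LB_entails_iff {Γ : Set Fm} {φ : Fm} :
    LB.Entails Γ φ ↔ ∀ h : Hom Fm Four, (∀ γ ∈ Γ, h γ ∈ Tr) → h φ ∈ Tr :=
  Iff.rfl

theorem IsBiprime.mem_Fi {P : Set A} (hP : IsBiprime P) : P ∈ Fi LB A := by
  obtain ⟨v, hv⟩ := hP.exists_hom
  intro Γ φ hφ h hΓ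
  exact (hv _).1 (LB_entails_iff.1 hφ (v.comp h) fun γ hγ => (hv _).2 (hΓ γ hγ))

/-! Homomorphisms from the algebra of formulas -/

/-- The value of a formula under an assignment of values to the variables. -/
def Fm.eval (f : ℕ → A) : Fm → A
  | .var n => f n
  | .tInf φ ψ => Alg.tInf (φ.eval f) (ψ.eval f)
  | .tSup φ ψ => Alg.tSup (φ.eval f) (ψ.eval f)
  | .kInf φ ψ => Alg.kInf (φ.eval f) (ψ.eval f)
  | .kSup φ ψ => Alg.kSup (φ.eval f) (ψ.eval f)
  | .neg φ => Alg.neg (φ.eval f)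

/-- The homomorphism that extends an assignment of values to the variables. -/
def Fm.lift (f : ℕ → A) : Hom Fm A where
  toFun := Fm.eval f
  map_tInf _ _ := rfl
  map_tSup _ _ := rfl
  map_kInf _ _ := rfl
  map_kSup _ _ := rfl
  map_neg _ := rfl

theorem Hom.eq_of_var {g h : Hom Fm A} (H : ∀ n, g (.var n) = h (.var n)) (φ : Fm) :
    g φ = h φ := by
  induction φ with
  | var n => exact H n
  | tInf φ ψ hφ hψ => exact (g.map_tInf φ ψ).trans (hφ ▸ hψ ▸ (h.map_tInf φ ψ).symm)
  | tSup φ ψ hφ hψ => exact (g.map_tSup φ ψ).trans (hφ ▸ hψ ▸ (h.map_tSup φ ψ).symm)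
  | kInf φ ψ hφ hψ => exact (g.map_kInf φ ψ).trans (hφ ▸ hψ ▸ (h.map_kInf φ ψ).symm)
  | kSup φ ψ hφ hψ => exact (g.map_kSup φ ψ).trans (hφ ▸ hψ ▸ (h.map_kSup φ ψ).symm)
  | neg φ hφ => exact (g.map_neg φ).trans (hφ ▸ (h.map_neg φ).symm)

/-- The empty set is prime; its homomorphism is the valuation constantly `⊥`, which designates
nothing. -/
theorem not_LB_hasTheorems : ¬ LB.HasTheorems := by
  rintro ⟨φ, hφ⟩
  have hP : IsBiprime (∅ : Set Fm) := by constructor <;> simp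
  obtain ⟨v, hv⟩ := hP.exists_hom
  exact (hv φ).1 (LB_entails_iff.1 hφ v (by simp))

theorem empty_mem_Fi : (∅ : Set A) ∈ Fi LB A := by
  have hP : IsBiprime (∅ : Set A) := by constructor <;> simp
  exact hP.mem_Fi

/-! Finitarity of `LB` -/

/-- Compactness: in the product of discrete finite spaces `ℕ → Four`, the valuations designating a
given formula form a closed set, and so do those refuting `φ`. An empty intersection of such sets is
already empty for finitely many members of `Γ`. -/
theorem LB_entails_finite {Γ : Set Fm} {φ : Fm} (hφ : LB.Entails Γ φ) :
    ∃ Δ : Set Fm, Δ.Finite ∧ Δ ⊆ Γ ∧ LB.Entails Δ φ := by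
  let _ : TopologicalSpace Four := ⊥
  have : DiscreteTopology Four := ⟨rfl⟩
  have : Finite Four := Finite.of_surjective
    (fun x : Bool × Bool => match x with
      | (true, true) => Four.top | (true, false) => .t | (false, true) => .f
      | (false, false) => .bot)
    (by rintro (_ | _ | _ | _)
        exacts [⟨(false, true), rfl⟩, ⟨(false, false), rfl⟩, ⟨(true, true), rfl⟩,
          ⟨(true, false), rfl⟩])
  have hc : ∀ ψ : Fm, Continuous fun f : ℕ → Four => Fm.lift f ψ := by
    intro ψ
    induction ψ with
    | var n => exact continuous_apply (A := fun _ : ℕ => Four) n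
    | tInf φ ψ hφ hψ =>
      exact (continuous_of_discreteTopology (f := fun x : Four × Four => tInf x.1 x.2)).comp
        (hφ.prodMk hψ)
    | tSup φ ψ hφ hψ =>
      exact (continuous_of_discreteTopology (f := fun x : Four × Four => tSup x.1 x.2)).comp
        (hφ.prodMk hψ)
    | kInf φ ψ hφ hψ =>
      exact (continuous_of_discreteTopology (f := fun x : Four × Four => kInf x.1 x.2)).comp
        (hφ.prodMk hψ)
    | kSup φ ψ hφ hψ =>
      exact (continuous_of_discreteTopology (f := fun x : Four × Four => kSup x.1 x.2)).comp
        (hφ.prodMk hψ)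
    | neg φ hφ =>
      exact (continuous_of_discreteTopology (f := fun x : Four => Alg.neg x)).comp hφ
  have hcl : ∀ (S : Set Four) (ψ : Fm), IsClosed {f : ℕ → Four | Fm.lift f ψ ∈ S} := fun S ψ =>
    (isClosed_discrete S).preimage (hc ψ)
  obtain ⟨s, hs⟩ := (hcl Trᶜ φ).isCompact.elim_finite_subfamily_closed
    (fun γ : Γ => {f : ℕ → Four | Fm.lift f γ ∈ Tr}) (fun γ => hcl Tr γ) (by
      rw [Set.eq_empty_iff_forall_notMem]
      rintro f ⟨h₁, h₂⟩
      exact h₁ (LB_entails_iff.1 hφ _ fun γ hγ => Set.mem_iInter.1 h₂ ⟨γ, hγ⟩))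
  refine ⟨(↑) '' (s : Set Γ), s.finite_toSet.image _, by simp, LB_entails_iff.2 fun h hh => ?_⟩
  by_contra hn
  have hl : ∀ ψ, Fm.lift (fun n => h (.var n)) ψ = h ψ := Hom.eq_of_var fun n => rfl
  refine Set.eq_empty_iff_forall_notMem.1 hs (fun n => h (.var n)) ⟨?_, ?_⟩
  · simpa [hl] using hn
  · simp only [Set.mem_iInter, Set.mem_ofPred_eq, hl]
    exact fun γ hγ => hh γ ⟨γ, hγ, rfl⟩

/-! Rules of `LB` in filters -/

/-- Transfer principle: a one-premise rule checked propositionally in prime sets of formulas is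
valid in LB, hence in all filters on all algebras. -/
theorem mem_of_mem_Fi {T : Set A} (hT : T ∈ Fi LB A) {φ ψ : Fm}
    (hφ : ∀ P : Set Fm, IsBiprime P → φ ∈ P → ψ ∈ P) (f : ℕ → A)
    (h : Fm.lift f φ ∈ T) : Fm.lift f ψ ∈ T :=
  hT {φ} ψ (LB_entails_iff.2 fun g hg => hφ _ (isBiprime_Tr.preimage g) (hg φ rfl)) _ (by simpa)

theorem mem_iff_of_mem_Fi {T : Set A} (hT : T ∈ Fi LB A) {φ ψ : Fm}
    (hφ : ∀ P : Set Fm, IsBiprime P → (φ ∈ P ↔ ψ ∈ P)) (f : ℕ → A) :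
    Fm.lift f φ ∈ T ↔ Fm.lift f ψ ∈ T :=
  ⟨mem_of_mem_Fi hT (fun P hP => (hφ P hP).1) f, mem_of_mem_Fi hT (fun P hP => (hφ P hP).2) f⟩

/-- The assignment of `a` to the variable `0` and of `b` to the other variables. -/
def assign (a b : A) : ℕ → A
  | 0 => a
  | _ + 1 => b

section

variable {T : Set A} (hT : T ∈ Fi LB A) (a b : A)
include hT

theorem kInf_mem_iff_of_mem_Fi : kInf a b ∈ T ↔ a ∈ T ∧ b ∈ T := by
  refine ⟨fun h => ⟨?_, ?_⟩, fun h => ?_⟩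
  · exact mem_of_mem_Fi hT (φ := kInf (.var 0) (.var 1)) (ψ := .var 0)
      (fun P hP => by simp +contextual [hP.kInf]) (assign a b) h
  · exact mem_of_mem_Fi hT (φ := kInf (.var 0) (.var 1)) (ψ := .var 1)
      (fun P hP => by simp +contextual [hP.kInf]) (assign a b) h
  · refine hT {.var 0, .var 1} (kInf (.var 0) (.var 1)) (LB_entails_iff.2 fun g hg => ?_)
      (Fm.lift (assign a b)) ?_
    · exact ((isBiprime_Tr.preimage g).kInf _ _).2 ⟨hg _ (by simp), hg _ (by simp)⟩
    · rintro γ (rfl | rfl)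
      exacts [h.1, h.2]

theorem tInf_mem_iff_kInf_mem_of_mem_Fi : tInf a b ∈ T ↔ kInf a b ∈ T :=
  mem_iff_of_mem_Fi hT (φ := tInf (.var 0) (.var 1)) (ψ := kInf (.var 0) (.var 1))
    (fun P hP => by simp [hP.kInf, hP.tInf]) (assign a b)

theorem tSup_mem_iff_kSup_mem_of_mem_Fi : tSup a b ∈ T ↔ kSup a b ∈ T :=
  mem_iff_of_mem_Fi hT (φ := tSup (.var 0) (.var 1)) (ψ := kSup (.var 0) (.var 1))
    (fun P hP => by simp [hP.kSup, hP.tSup]) (assign a b)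

theorem tSup_comm_of_mem_Fi (h : tSup a b ∈ T) : tSup b a ∈ T :=
  mem_of_mem_Fi hT (φ := tSup (.var 0) (.var 1)) (ψ := tSup (.var 1) (.var 0))
    (fun P hP => by simp [hP.tSup, or_comm]) (assign a b) h

theorem tSup_mem_of_mem_Fi_left (h : a ∈ T) : tSup a b ∈ T :=
  mem_of_mem_Fi hT (φ := .var 0) (ψ := tSup (.var 0) (.var 1))
    (fun P hP => by simp +contextual [hP.tSup]) (assign a b) h

theorem tSup_self_of_mem_Fi (h : tSup a a ∈ T) : a ∈ T :=
  mem_of_mem_Fi hT (φ := tSup (.var 0) (.var 0)) (ψ := .var 0)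
    (fun P hP => by simp [hP.tSup]) (assign a a) h

theorem neg_neg_mem_iff_of_mem_Fi : neg (neg a) ∈ T ↔ a ∈ T :=
  mem_iff_of_mem_Fi hT (φ := neg (neg (.var 0))) (ψ := .var 0)
    (fun P hP => by simp [hP.neg_neg]) (assign a a)

theorem neg_tInf_mem_iff_of_mem_Fi : neg (tInf a b) ∈ T ↔ tSup (neg a) (neg b) ∈ T :=
  mem_iff_of_mem_Fi hT (φ := neg (tInf (.var 0) (.var 1)))
    (ψ := tSup (neg (.var 0)) (neg (.var 1)))
    (fun P hP => by simp [hP.neg_tInf, hP.tSup]) (assign a b)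

theorem neg_tSup_mem_iff_of_mem_Fi : neg (tSup a b) ∈ T ↔ tInf (neg a) (neg b) ∈ T :=
  mem_iff_of_mem_Fi hT (φ := neg (tSup (.var 0) (.var 1)))
    (ψ := tInf (neg (.var 0)) (neg (.var 1)))
    (fun P hP => by simp [hP.neg_tSup, hP.tInf]) (assign a b)

theorem neg_kInf_mem_iff_of_mem_Fi : neg (kInf a b) ∈ T ↔ kInf (neg a) (neg b) ∈ T :=
  mem_iff_of_mem_Fi hT (φ := neg (kInf (.var 0) (.var 1)))
    (ψ := kInf (neg (.var 0)) (neg (.var 1)))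
    (fun P hP => by simp [hP.neg_kInf, hP.kInf]) (assign a b)

theorem neg_kSup_mem_iff_of_mem_Fi : neg (kSup a b) ∈ T ↔ kSup (neg a) (neg b) ∈ T :=
  mem_iff_of_mem_Fi hT (φ := neg (kSup (.var 0) (.var 1)))
    (ψ := kSup (neg (.var 0)) (neg (.var 1)))
    (fun P hP => by simp [hP.neg_kSup, hP.kSup]) (assign a b)

/-- Entailment in LB survives disjoining a side formula everywhere: a valuation either designates
the side formula or designates all the original premises. This gives the hard half of (PDI). -/
theorem setOf_tSup_mem_Fi : {c | tSup c b ∈ T} ∈ Fi LB A := by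
  intro Γ φ hφ h hΓ
  -- Shifting all variables up by one frees variable `0` to stand for `b`.
  let σ : Hom Fm Fm := Fm.lift fun n => .var (n + 1)
  let f : ℕ → A := fun n => Nat.casesOn n b fun n => h (.var n)
  have hσ : ∀ ψ, Fm.lift f (σ ψ) = h ψ :=
    Hom.eq_of_var (g := (Fm.lift f).comp σ) (h := h) fun n => rfl
  have hf : ∀ ψ, Fm.lift f (tSup (σ ψ) (.var 0)) = tSup (h ψ) b := fun ψ => by
    rw [Hom.map_tSup, hσ]; rfl
  rw [Set.mem_ofPred_eq, ← hf]
  refine hT ((fun γ => tSup (σ γ) (.var 0)) '' Γ) _ (LB_entails_iff.2 fun g hg => ?_) _ ?_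
  · have hP := isBiprime_Tr.preimage g
    by_cases h₀ : g (.var 0) ∈ Tr
    · exact (hP.tSup _ _).2 (Or.inr h₀)
    · exact (hP.tSup _ _).2 (Or.inl (LB_entails_iff.1 hφ (g.comp σ) fun γ hγ =>
        ((hP.tSup _ _).1 (hg _ ⟨γ, hγ, rfl⟩)).resolve_right h₀))
  · rintro _ ⟨γ, hγ, rfl⟩
    rw [hf]
    exact hΓ γ hγ

end

/-! Full models satisfy the Tarski-style conditions -/

/-- The conjunction of finitarity and the Tarski-style conditions. -/
structure IsTarskiModel (C : ClosureOperator (Set A)) : Prop where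
  finitary : Finitary C
  propE : PropE C
  propPC : PropPC C
  propPDI : PropPDI C
  propPDN : PropPDN C
  propPDM : PropPDM C

/-- Reduces every condition on `C` to a statement about the members of `𝒟`. -/
theorem IsBilogicalMorphism.mem_iff {C : ClosureOperator (Set A)} {𝒟 : Set (Set B)} {h : Hom A B}
    (H : IsBilogicalMorphism (closureSystem C) 𝒟 h) {X : Set A} {a : A} :
    a ∈ C X ↔ ∀ T ∈ 𝒟, (∀ x ∈ X, h x ∈ T) → h a ∈ T := by
  constructor
  · intro ha T hT hX
    have hc : h ⁻¹' T ∈ closureSystem C := by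
      rw [H.2]
      exact ⟨T, hT, rfl⟩
    exact C.closure_min (show X ≤ h ⁻¹' T from hX) hc ha
  · intro ha
    have hc : C X ∈ closureSystem C := C.isClosed_closure X
    rw [H.2] at hc
    obtain ⟨T, hT, hX⟩ := hc
    rw [hX]
    exact ha T hT fun x hx => (hX ▸ C.le_closure X hx : x ∈ h ⁻¹' T)

theorem IsFullModel.isTarskiModel {C : ClosureOperator (Set A)} (hC : IsFullModel LB C) :
    IsTarskiModel C := by
  obtain ⟨B, _, h, H⟩ := hC
  have hsing : ∀ a b : A, (∀ T ∈ Fi LB B, (h a ∈ T ↔ h b ∈ T)) → C {a} = C {b} := by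
    intro a b hab
    ext x
    simp +contextual [H.mem_iff, hab]
  have hSup : ∀ (X : Set A) (a b : A), C (X ∪ {tSup a b}) = C (X ∪ {kSup a b}) := by
    intro X a b
    ext x
    rw [H.mem_iff, H.mem_iff]
    refine forall₂_congr fun T hT => ?_
    simp [or_imp, forall_and, h.map_tSup, h.map_kSup, tSup_mem_iff_kSup_mem_of_mem_Fi hT]
  refine ⟨?_, ?_, ?_, ?_, ?_, ?_⟩
  · intro X a ha
    -- The elements generated by finitely many members of `X`. They form a filter because LB is
    -- finitary: a finite set of premises uses only finitely many generators in all.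
    let T₀ : Set B :=
      {b | ∃ Y : Set A, Y.Finite ∧ Y ⊆ X ∧ ∀ T ∈ Fi LB B, (∀ y ∈ Y, h y ∈ T) → b ∈ T}
    have hT₀ : T₀ ∈ Fi LB B := by
      intro Γ φ hφ g hg
      obtain ⟨Δ, hΔ, hΔΓ, hφ'⟩ := LB_entails_finite hφ
      choose! Y hY hYX hYT using fun γ (hγ : γ ∈ Δ) => hg γ (hΔΓ hγ)
      refine ⟨⋃ γ ∈ Δ, Y γ, hΔ.biUnion hY, Set.iUnion₂_subset hYX, fun T hT hy => ?_⟩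
      exact hT Δ φ hφ' g fun γ hγ => hYT γ hγ T hT fun y hy' => hy y (Set.mem_biUnion hγ hy')
    obtain ⟨Y, hY, hYX, hYT⟩ := H.mem_iff.1 ha T₀ hT₀ fun x hx =>
      ⟨{x}, Set.finite_singleton x, Set.singleton_subset_iff.2 hx, fun T _ hx => hx x rfl⟩
    exact ⟨Y, hY, hYX, H.mem_iff.2 hYT⟩
  · refine Set.eq_empty_iff_forall_notMem.2 fun a ha => ?_
    exact H.mem_iff.1 ha ∅ empty_mem_Fi (by simp)
  · refine fun a b => ⟨hsing _ _ fun T hT => ?_, ?_⟩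
    · rw [h.map_tInf, h.map_kInf, tInf_mem_iff_kInf_mem_of_mem_Fi hT]
    · ext x
      rw [H.mem_iff, H.mem_iff]
      refine forall₂_congr fun T hT => ?_
      simp [h.map_kInf, kInf_mem_iff_of_mem_Fi hT]
  · refine fun X a b => ⟨hSup X a b, ?_⟩
    rw [← hSup]
    ext x
    rw [Set.mem_inter_iff, H.mem_iff, H.mem_iff, H.mem_iff]
    constructor
    · refine fun hx => ⟨fun T hT hX => hx T hT ?_, fun T hT hX => hx T hT ?_⟩
      · rintro y (hy | rfl)
        · exact hX y (Or.inl hy)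
        · rw [h.map_tSup]
          exact tSup_mem_of_mem_Fi_left hT _ _ (hX a (Or.inr rfl))
      · rintro y (hy | rfl)
        · exact hX y (Or.inl hy)
        · rw [h.map_tSup]
          exact tSup_comm_of_mem_Fi hT _ _
            (tSup_mem_of_mem_Fi_left hT _ _ (hX b (Or.inr rfl)))
    -- Reasoning by cases inside `T`: from `a ∨ b`, the filter `{c | c ∨ b ∈ T}` gives `x ∨ b`; then
    -- `{c | c ∨ x ∈ T}` gives `x ∨ x`, and so `x`.
    · rintro ⟨ha, hb⟩ T hT hX
      have hab : tSup (h a) (h b) ∈ T := h.map_tSup a b ▸ hX _ (Or.inr rfl)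
      have hxb : tSup (h x) (h b) ∈ T := by
        refine ha _ (setOf_tSup_mem_Fi hT (h b)) ?_
        rintro y (hy | rfl)
        · exact tSup_mem_of_mem_Fi_left hT _ _ (hX y (Or.inl hy))
        · exact hab
      refine tSup_self_of_mem_Fi hT _ (hb _ (setOf_tSup_mem_Fi hT (h x)) ?_)
      rintro y (hy | rfl)
      · exact tSup_mem_of_mem_Fi_left hT _ _ (hX y (Or.inl hy))
      · exact tSup_comm_of_mem_Fi hT _ _ hxb
  · refine fun a => hsing _ _ fun T hT => ?_
    rw [h.map_neg, h.map_neg, neg_neg_mem_iff_of_mem_Fi hT]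
  · refine fun a b => ⟨hsing _ _ fun T hT => ?_, hsing _ _ fun T hT => ?_, hsing _ _ fun T hT => ?_,
      hsing _ _ fun T hT => ?_⟩
    · simp only [h.map_neg, h.map_tInf, h.map_tSup, neg_tInf_mem_iff_of_mem_Fi hT]
    · simp only [h.map_neg, h.map_tInf, h.map_tSup, neg_tSup_mem_iff_of_mem_Fi hT]
    · simp only [h.map_neg, h.map_kInf, neg_kInf_mem_iff_of_mem_Fi hT]
    · simp only [h.map_neg, h.map_kSup, neg_kSup_mem_iff_of_mem_Fi hT]

/-! The Tarski-style conditions: closures of compound elements and prime extensions -/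

/-- Lets the closures of compounds and of their negations be expressed by the closures of `a`, `b`,
`neg a` and `neg b` alone, as joins or intersections. Compatibility of `tarskiSetoid` with the
operations follows by rewriting. -/
theorem closure_pair {A : Type*} (C : ClosureOperator (Set A)) (a b : A) :
    C {a, b} = C (C {a} ∪ C {b}) := by
  rw [Set.insert_eq]
  exact (C.closure_sup_closure _ _).symm

theorem closed_mem_iff {A : Type*} {C : ClosureOperator (Set A)} {P : Set A} (hP : C.IsClosed P) {a : A} :
    a ∈ P ↔ C {a} ⊆ P :=
  ⟨fun h => C.closure_min (Set.singleton_subset_iff.2 h) hP, fun h => h (C.le_closure _ rfl)⟩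

/-- Elements are identified when they have the same closure and so do their negations. For abstract
logics with the Tarski-style conditions, this is the Tarski congruence. -/
def tarskiSetoid (C : ClosureOperator (Set A)) : Setoid A where
  r a b := C {a} = C {b} ∧ C {neg a} = C {neg b}
  iseqv := ⟨fun _ => ⟨rfl, rfl⟩, fun h => ⟨h.1.symm, h.2.symm⟩,
    fun h h' => ⟨h.1.trans h'.1, h.2.trans h'.2⟩⟩

namespace IsTarskiModel

variable {C : ClosureOperator (Set A)} (hC : IsTarskiModel C) (a b : A)
include hC

theorem closure_kInf : C {kInf a b} = C (C {a} ∪ C {b}) := by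
  rw [(hC.propPC a b).2, closure_pair]

theorem closure_tInf : C {tInf a b} = C (C {a} ∪ C {b}) := by
  rw [(hC.propPC a b).1, hC.closure_kInf]

theorem closure_kSup : C {kSup a b} = C {a} ∩ C {b} := by
  simpa using (hC.propPDI ∅ a b).2

theorem closure_tSup : C {tSup a b} = C {a} ∩ C {b} := by
  rw [← hC.closure_kSup]
  simpa using (hC.propPDI ∅ a b).1

theorem closure_neg_neg : C {neg (neg a)} = C {a} := (hC.propPDN a).symm

theorem closure_neg_tInf : C {neg (tInf a b)} = C {neg a} ∩ C {neg b} := by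
  rw [(hC.propPDM a b).1, hC.closure_tSup]

theorem closure_neg_tSup : C {neg (tSup a b)} = C (C {neg a} ∪ C {neg b}) := by
  rw [(hC.propPDM a b).2.1, hC.closure_tInf]

theorem closure_neg_kInf : C {neg (kInf a b)} = C (C {neg a} ∪ C {neg b}) := by
  rw [(hC.propPDM a b).2.2.1, hC.closure_kInf]

theorem closure_neg_kSup : C {neg (kSup a b)} = C {neg a} ∩ C {neg b} := by
  rw [(hC.propPDM a b).2.2.2, hC.closure_kSup]

/-- The conjunctive clauses hold in any closed set. For the disjunctive ones, if `a` and `b` are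
both outside `P`, adding either generates `c`; if `kSup a b` were in `P`, (PDI) would put `c` in `C
P = P`. -/
theorem isBiprime_of_maximal {P : Set A} {c : A}
    (hP : Maximal (fun P => C.IsClosed P ∧ c ∉ P) P) : IsBiprime P := by
  have hcl : C.IsClosed P := hP.prop.1
  have hpair : ∀ a b, C (C {a} ∪ C {b}) ⊆ P ↔ a ∈ P ∧ b ∈ P := by
    intro a b
    rw [closed_mem_iff hcl, closed_mem_iff hcl, ← Set.union_subset_iff]
    exact hcl.closure_le_iff
  have hmax : ∀ a, a ∉ P → c ∈ C (P ∪ {a}) := by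
    intro a ha
    by_contra hc
    exact ha (hP.le_of_ge ⟨C.isClosed_closure _, hc⟩
      (Set.subset_union_left.trans (C.le_closure _)) (C.le_closure _ (Or.inr rfl)))
  have hor : ∀ a b, C {a} ∩ C {b} ⊆ P ↔ a ∈ P ∨ b ∈ P := by
    intro a b
    constructor
    · intro hab
      by_contra! hn
      rw [← hC.closure_kSup, ← closed_mem_iff hcl] at hab
      refine hP.prop.2 (hcl.closure_eq ▸ ?_)
      rw [← Set.union_eq_self_of_subset_right (Set.singleton_subset_iff.2 hab),
        (hC.propPDI P a b).2]
      exact ⟨hmax a hn.1, hmax b hn.2⟩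
    · rintro (h | h)
      · exact Set.inter_subset_left.trans ((closed_mem_iff hcl).1 h)
      · exact Set.inter_subset_right.trans ((closed_mem_iff hcl).1 h)
  constructor <;> intros <;> rw [closed_mem_iff hcl]
  · rw [hC.closure_tInf, hpair]
  · rw [hC.closure_tSup, hor]
  · rw [hC.closure_kInf, hpair]
  · rw [hC.closure_kSup, hor]
  · rw [hC.closure_neg_tInf, hor]
  · rw [hC.closure_neg_tSup, hpair]
  · rw [hC.closure_neg_kInf, hpair]
  · rw [hC.closure_neg_kSup, hor]
  · rw [hC.closure_neg_neg, closed_mem_iff hcl]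

/-- Zorn's lemma applies because finitarity makes unions of nonempty chains of closed sets closed.
-/
theorem exists_isBiprime {X : Set A} {c : A} (hc : c ∉ C X) :
    ∃ P, C.IsClosed P ∧ IsBiprime P ∧ X ⊆ P ∧ c ∉ P := by
  obtain ⟨P, hXP, hP⟩ := zorn_subset_nonempty {P | C.IsClosed P ∧ c ∉ P} (fun S hS hch hne => by
    refine ⟨⋃₀ S, ⟨C.isClosed_iff_closure_le.2 fun x hx => ?_, ?_⟩,
      fun s hs => Set.subset_sUnion_of_mem hs⟩
    · obtain ⟨Y, hY, hYS, hxY⟩ := hC.finitary _ _ hx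
      obtain ⟨s, hs, hYs⟩ := hch.directedOn.exists_mem_subset_of_finite_of_subset_sUnion hne hY hYS
      exact ⟨s, hs, C.closure_min hYs (hS hs).1 hxY⟩
    · rintro ⟨s, hs, hcs⟩
      exact (hS hs).2 hcs) (C X) ⟨C.isClosed_closure X, hc⟩
  exact ⟨P, hP.prop.1, hC.isBiprime_of_maximal hP, (C.le_closure X).trans hXP, hP.prop.2⟩

theorem mem_Fi_of_isClosed {T : Set A} (hT : C.IsClosed T) : T ∈ Fi LB A := by
  intro Γ φ hφ h hΓ
  by_contra hn
  rw [← hT.closure_eq] at hn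
  obtain ⟨P, -, hP, hTP, hφP⟩ := hC.exists_isBiprime hn
  exact hφP (hP.mem_Fi Γ φ hφ h fun γ hγ => hTP (hΓ γ hγ))

/-! The quotient by the Tarski congruence -/

/-- The quotient algebra by the Tarski congruence. -/
@[reducible] def quotientAlg : Alg (Quotient (tarskiSetoid C)) where
  tInf := Quotient.map₂ tInf fun a a' h b b' h' => by
    constructor <;> simp only [hC.closure_tInf, hC.closure_neg_tInf, h.1, h.2, h'.1, h'.2]
  tSup := Quotient.map₂ tSup fun a a' h b b' h' => by
    constructor <;> simp only [hC.closure_tSup, hC.closure_neg_tSup, h.1, h.2, h'.1, h'.2]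
  kInf := Quotient.map₂ kInf fun a a' h b b' h' => by
    constructor <;> simp only [hC.closure_kInf, hC.closure_neg_kInf, h.1, h.2, h'.1, h'.2]
  kSup := Quotient.map₂ kSup fun a a' h b b' h' => by
    constructor <;> simp only [hC.closure_kSup, hC.closure_neg_kSup, h.1, h.2, h'.1, h'.2]
  neg := Quotient.map neg fun a a' h => by
    constructor <;> simp only [hC.closure_neg_neg, h.1, h.2]

/-- The conjunction of `Y` serves as the single generator and stays in the filter. -/
theorem exists_closure_eq_singleton {Y : Set A} (hY : Y.Finite) (hne : Y.Nonempty)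
    {T : Set A} (hT : T ∈ Fi LB A) (hYT : Y ⊆ T) : ∃ a ∈ T, C Y = C {a} := by
  induction Y, hY using Set.Finite.induction_on with
  | empty => exact absurd hne (by simp)
  | @insert y Y _ _ ih =>
    rw [Set.insert_subset_iff] at hYT
    rcases Y.eq_empty_or_nonempty with rfl | hY
    · exact ⟨y, hYT.1, by simp⟩
    · obtain ⟨a, ha, hYa⟩ := ih hY hYT.2
      refine ⟨kInf y a, (kInf_mem_iff_of_mem_Fi hT y a).2 ⟨hYT.1, ha⟩, ?_⟩
      rw [hC.closure_kInf, ← hYa, Set.insert_eq]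
      exact (C.closure_sup_closure _ _).symm

theorem isFullModel : IsFullModel LB C := by
  let _ := hC.quotientAlg
  let π : Hom A (Quotient (tarskiSetoid C)) :=
    ⟨Quotient.mk _, fun _ _ => rfl, fun _ _ => rfl, fun _ _ => rfl, fun _ _ => rfl, fun _ => rfl⟩
  have hπ : Function.Surjective π := Quotient.mk_surjective
  refine ⟨_, hC.quotientAlg, π, hπ, ?_⟩
  ext X
  constructor
  · intro hX
    -- Closed sets are unions of classes, since membership depends only on `C {a}`.
    have hXπ : ∀ a, π a ∈ π '' X ↔ a ∈ X := by
      refine fun a => ⟨?_, fun ha => ⟨a, ha, rfl⟩⟩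
      rintro ⟨b, hb, hba⟩
      rw [closed_mem_iff hX, ← (Quotient.exact hba).1, ← closed_mem_iff hX]
      exact hb
    refine ⟨π '' X, ?_, Set.ext fun a => (hXπ a).symm⟩
    intro Γ φ hφ g hg
    -- A valuation in the quotient lifts to `A` by choosing representatives for the variables.
    choose f hf using fun n => hπ (g (.var n))
    have hl : ∀ ψ, π (Fm.lift f ψ) = g ψ := Hom.eq_of_var (g := π.comp (Fm.lift f)) hf
    rw [← hl, hXπ]
    refine hC.mem_Fi_of_isClosed hX Γ φ hφ _ fun γ hγ => ?_
    rw [← hXπ, hl]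
    exact hg γ hγ
  · rintro ⟨T, hT, rfl⟩
    have hT' : π ⁻¹' T ∈ Fi LB A := fun Γ φ hφ g hg => hT Γ φ hφ (π.comp g) hg
    refine C.isClosed_iff_closure_le.2 fun c hc => ?_
    obtain ⟨Y, hY, hYT, hcY⟩ := hC.finitary _ _ hc
    have hne : Y.Nonempty := by
      rw [Set.nonempty_iff_ne_empty]
      rintro rfl
      rw [hC.propE] at hcY
      exact hcY
    obtain ⟨a, ha, hYa⟩ := hC.exists_closure_eq_singleton hY hne hT' hYT
    have hca : C {c} ⊆ C {a} := (closed_mem_iff (C.isClosed_closure _)).1 (hYa ▸ hcY)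
    have hac : kSup a c ∈ π ⁻¹' T := (tSup_mem_iff_kSup_mem_of_mem_Fi hT' a c).1
      (tSup_mem_of_mem_Fi_left hT' a c ha)
    -- Both elements have closure `C {c}`, because `C {c} ⊆ C {a}`; both negations have closure `C
    -- {neg a} ∩ C {neg c}`. Mixing the two orders is essential: `∧` is conjunctive, as needed to
    -- extract `c`, yet its negation behaves like that of `⊕`.
    have heq : π (kSup a c) = π (tInf c (kSup c a)) := by
      refine Quotient.sound ⟨?_, ?_⟩
      · rw [hC.closure_tInf, hC.closure_kSup, hC.closure_kSup, Set.inter_eq_right.2 hca,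
          Set.inter_eq_left.2 hca, Set.union_self]
        exact (C.idempotent _).symm
      · rw [hC.closure_neg_tInf, hC.closure_neg_kSup, hC.closure_neg_kSup, ← Set.inter_assoc,
          Set.inter_self, Set.inter_comm]
    have hT'' : tInf c (kSup c a) ∈ π ⁻¹' T := by
      rw [Set.mem_preimage, ← heq]
      exact hac
    exact ((kInf_mem_iff_of_mem_Fi hT' _ _).1
      ((tInf_mem_iff_kInf_mem_of_mem_Fi hT' _ _).1 hT'')).1

end IsTarskiModel

theorem isFullModel_LB_iff {C : ClosureOperator (Set A)} :
    IsFullModel LB C ↔ IsTarskiModel C :=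
  ⟨IsFullModel.isTarskiModel, IsTarskiModel.isFullModel⟩

/-! Models of the Gentzen calculus -/

theorem Derivable.sound {H : Set Sequent} {P : Set Fm} (hP : IsBiprime P)
    (hH : ∀ S ∈ H, (∀ γ ∈ S.ant, γ ∈ P) → ∃ δ ∈ S.suc, δ ∈ P) {Γ Δ : Finset Fm}
    (hd : Derivable H Γ Δ) : (∀ γ ∈ Γ, γ ∈ P) → ∃ δ ∈ Δ, δ ∈ P := by
  -- The clauses are restated with the constructors of `Fm`, the form in which the rules mention
  -- them.
  have h₁ : ∀ a b, Fm.tInf a b ∈ P ↔ a ∈ P ∧ b ∈ P := hP.tInf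
  have h₂ : ∀ a b, Fm.tSup a b ∈ P ↔ a ∈ P ∨ b ∈ P := hP.tSup
  have h₃ : ∀ a b, Fm.kInf a b ∈ P ↔ a ∈ P ∧ b ∈ P := hP.kInf
  have h₄ : ∀ a b, Fm.kSup a b ∈ P ↔ a ∈ P ∨ b ∈ P := hP.kSup
  have h₅ : ∀ a b, (Fm.tInf a b).neg ∈ P ↔ a.neg ∈ P ∨ b.neg ∈ P := hP.neg_tInf
  have h₆ : ∀ a b, (Fm.tSup a b).neg ∈ P ↔ a.neg ∈ P ∧ b.neg ∈ P := hP.neg_tSup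
  have h₇ : ∀ a b, (Fm.kInf a b).neg ∈ P ↔ a.neg ∈ P ∧ b.neg ∈ P := hP.neg_kInf
  have h₈ : ∀ a b, (Fm.kSup a b).neg ∈ P ↔ a.neg ∈ P ∨ b.neg ∈ P := hP.neg_kSup
  have h₉ : ∀ a, (Fm.neg a).neg ∈ P ↔ a ∈ P := hP.neg_neg
  induction hd with
  | hyp S hS => exact hH S hS
  | ax Γ Δ φ => exact fun h => ⟨φ, by simp, h φ (by simp)⟩
  | cut Γ₁ Δ₁ Γ₂ Δ₂ φ _ _ ih₁ ih₂ =>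
    intro h
    obtain ⟨δ, hδ, hδP⟩ := ih₁ fun γ hγ => h γ (Finset.mem_union_left _ hγ)
    rcases Finset.mem_insert.1 hδ with rfl | hδ
    · obtain ⟨δ', hδ', hδP'⟩ := ih₂ <| (Finset.forall_mem_insert _ _ _).2
        ⟨hδP, fun γ hγ => h γ (Finset.mem_union_right _ hγ)⟩
      exact ⟨δ', Finset.mem_union_right _ hδ', hδP'⟩
    · exact ⟨δ, Finset.mem_union_left _ hδ, hδP⟩
  | _ =>
    simp only [Finset.forall_mem_insert, Finset.exists_mem_insert, h₁, h₂, h₃, h₄, h₅, h₆, h₇, h₈,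
      h₉] at *
    tauto

/-- A failing conclusion is separated by a prime `P` that is also closed. Closedness makes the
premises true in `h ⁻¹' P`, and primeness carries truth through the derivation. -/
theorem IsTarskiModel.isGentzenModel {C : ClosureOperator (Set A)} (hC : IsTarskiModel C) :
    IsGentzenModel GLB C := by
  intro I Γ hΓ φ Γ₀ hΓ₀ φ₀ hd h hh
  by_contra hn
  obtain ⟨P, hcl, hP, hΓP, hφP⟩ := hC.exists_isBiprime hn
  have := Derivable.sound (hP.preimage h) ?_ hd fun γ hγ => hΓP ⟨γ, hγ, rfl⟩
  · simp only [Sequent.single, Finset.mem_singleton, exists_eq_left] at this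
    exact hφP this
  · rintro _ ⟨i, rfl⟩ hi
    refine ⟨φ i, by simp [Sequent.single], C.closure_min ?_ hcl (hh i)⟩
    rintro _ ⟨γ, hγ, rfl⟩
    exact hi γ hγ

theorem Derivable.of_mem {H : Set Sequent} {Γ Δ : Finset Fm} (φ : Fm) (h₁ : φ ∈ Γ) (h₂ : φ ∈ Δ) :
    Derivable H Γ Δ := by
  rw [← Finset.insert_eq_self.2 h₁, ← Finset.insert_eq_self.2 h₂]
  exact .ax Γ Δ φ

/-- Names the elements of `Y` by variables, so that `Y` can serve as the context of a sequent; `a`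
is only a default value. -/
theorem exists_finset_image_eq {A : Type*} {Y : Set A} (hY : Y.Finite) (a : A) :
    ∃ (f : ℕ → A) (S : Finset ℕ), f '' S = Y := by
  have := hY.to_subtype
  obtain ⟨e, he⟩ := exists_injective_nat Y
  refine ⟨Function.extend e (↑) fun _ => a, (Set.finite_range e).toFinset, ?_⟩
  ext x
  simp [he.extend_apply]

namespace IsGentzenModel

variable {C : ClosureOperator (Set A)} (hG : IsGentzenModel GLB C)
include hG

theorem mem_closure_of_derivable {Γ : Finset Fm} {φ : Fm}
    (hd : Derivable ∅ Γ (insert φ ∅)) (f : ℕ → A) : Fm.lift f φ ∈ C (Fm.lift f '' Γ) := by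
  refine hG Empty Empty.rec (fun i => i.elim) Empty.rec Γ hd.nonempty.1 φ ?_ (Fm.lift f)
    fun i => i.elim
  rw [Set.range_eq_empty]
  exact hd

theorem closure_le_of_derivable {φ ψ : Fm} (hd : Derivable ∅ (insert φ ∅) (insert ψ ∅))
    (f : ℕ → A) : C {Fm.lift f ψ} ⊆ C {Fm.lift f φ} := by
  refine C.closure_min (Set.singleton_subset_iff.2 ?_) (C.isClosed_closure _)
  simpa using hG.mem_closure_of_derivable hd f

theorem closure_eq_of_derivable {φ ψ : Fm} (hd : Derivable ∅ (insert φ ∅) (insert ψ ∅))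
    (hd' : Derivable ∅ (insert ψ ∅) (insert φ ∅)) (f : ℕ → A) :
    C {Fm.lift f φ} = C {Fm.lift f ψ} :=
  (hG.closure_le_of_derivable hd' f).antisymm (hG.closure_le_of_derivable hd f)

theorem propPC : PropPC C := by
  refine fun a b => ⟨?_, ?_⟩
  · refine hG.closure_eq_of_derivable (φ := .tInf (.var 0) (.var 1))
      (ψ := .kInf (.var 0) (.var 1)) ?_ ?_ (assign a b)
    · exact .tInf_left _ _ _ _ (.kInf_right _ _ _ _ (.of_mem (.var 0) (by simp) (by simp))
        (.of_mem (.var 1) (by simp) (by simp)))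
    · exact .kInf_left _ _ _ _ (.tInf_right _ _ _ _ (.of_mem (.var 0) (by simp) (by simp))
        (.of_mem (.var 1) (by simp) (by simp)))
  · apply Set.Subset.antisymm
    · refine C.closure_min (Set.singleton_subset_iff.2 ?_) (C.isClosed_closure _)
      have := hG.mem_closure_of_derivable (Γ := {.var 0, .var 1}) (φ := .kInf (.var 0) (.var 1))
        (.kInf_right _ _ _ _ (.of_mem (.var 0) (by simp) (by simp))
          (.of_mem (.var 1) (by simp) (by simp))) (assign a b)
      rw [Finset.coe_pair, Set.image_pair] at this
      exact this
    · refine C.closure_min (Set.insert_subset_iff.2 ⟨?_, Set.singleton_subset_iff.2 ?_⟩)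
        (C.isClosed_closure _)
      · exact hG.closure_le_of_derivable (φ := .kInf (.var 0) (.var 1)) (ψ := .var 0)
          (.kInf_left _ _ _ _ (.of_mem (.var 0) (by simp) (by simp))) (assign a b)
          (C.le_closure _ rfl)
      · exact hG.closure_le_of_derivable (φ := .kInf (.var 0) (.var 1)) (ψ := .var 1)
          (.kInf_left _ _ _ _ (.of_mem (.var 1) (by simp) (by simp))) (assign a b)
          (C.le_closure _ rfl)

theorem propPDN : PropPDN C := by
  refine fun a => hG.closure_eq_of_derivable (φ := .var 0) (ψ := .neg (.neg (.var 0))) ?_ ?_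
    (assign a a)
  · exact .neg_neg_right _ _ _ (.of_mem (.var 0) (by simp) (by simp))
  · exact .neg_neg_left _ _ _ (.of_mem (.var 0) (by simp) (by simp))

theorem propPDM : PropPDM C := by
  refine fun a b => ⟨?_, ?_, ?_, ?_⟩
  · refine hG.closure_eq_of_derivable (φ := .neg (.tInf (.var 0) (.var 1)))
      (ψ := .tSup (.neg (.var 0)) (.neg (.var 1))) ?_ ?_ (assign a b)
    · exact .neg_tInf_left _ _ _ _
        (.tSup_right _ _ _ _ (.of_mem (.neg (.var 0)) (by simp) (by simp)))
        (.tSup_right _ _ _ _ (.of_mem (.neg (.var 1)) (by simp) (by simp)))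
    · exact .tSup_left _ _ _ _
        (.neg_tInf_right _ _ _ _ (.of_mem (.neg (.var 0)) (by simp) (by simp)))
        (.neg_tInf_right _ _ _ _ (.of_mem (.neg (.var 1)) (by simp) (by simp)))
  · refine hG.closure_eq_of_derivable (φ := .neg (.tSup (.var 0) (.var 1)))
      (ψ := .tInf (.neg (.var 0)) (.neg (.var 1))) ?_ ?_ (assign a b)
    · exact .neg_tSup_left _ _ _ _ (.tInf_right _ _ _ _
        (.of_mem (.neg (.var 0)) (by simp) (by simp)) (.of_mem (.neg (.var 1)) (by simp) (by simp)))
    · exact .tInf_left _ _ _ _ (.neg_tSup_right _ _ _ _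
        (.of_mem (.neg (.var 0)) (by simp) (by simp)) (.of_mem (.neg (.var 1)) (by simp) (by simp)))
  · refine hG.closure_eq_of_derivable (φ := .neg (.kInf (.var 0) (.var 1)))
      (ψ := .kInf (.neg (.var 0)) (.neg (.var 1))) ?_ ?_ (assign a b)
    · exact .neg_kInf_left _ _ _ _ (.kInf_right _ _ _ _
        (.of_mem (.neg (.var 0)) (by simp) (by simp)) (.of_mem (.neg (.var 1)) (by simp) (by simp)))
    · exact .kInf_left _ _ _ _ (.neg_kInf_right _ _ _ _
        (.of_mem (.neg (.var 0)) (by simp) (by simp)) (.of_mem (.neg (.var 1)) (by simp) (by simp)))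
  · refine hG.closure_eq_of_derivable (φ := .neg (.kSup (.var 0) (.var 1)))
      (ψ := .kSup (.neg (.var 0)) (.neg (.var 1))) ?_ ?_ (assign a b)
    · exact .neg_kSup_left _ _ _ _
        (.kSup_right _ _ _ _ (.of_mem (.neg (.var 0)) (by simp) (by simp)))
        (.kSup_right _ _ _ _ (.of_mem (.neg (.var 1)) (by simp) (by simp)))
    · exact .kSup_left _ _ _ _
        (.neg_kSup_right _ _ _ _ (.of_mem (.neg (.var 0)) (by simp) (by simp)))
        (.neg_kSup_right _ _ _ _ (.of_mem (.neg (.var 1)) (by simp) (by simp)))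

theorem mem_closure_kSup_of_finite {Y : Set A} (hY : Y.Finite) {a b c : A}
    (ha : c ∈ C (Y ∪ {a})) (hb : c ∈ C (Y ∪ {b})) : c ∈ C (Y ∪ {kSup a b}) := by
  obtain ⟨f, S, rfl⟩ := exists_finset_image_eq hY a
  -- Variables `0`, `1`, `2` name `a`, `b`, `c`; the shift by three keeps the names of `Y` apart
  -- from them.
  let g : ℕ → A
    | 0 => a
    | 1 => b
    | 2 => c
    | n + 3 => f n
  let Γ : Finset Fm := S.image fun n => .var (n + 3)
  have hΓ : ∀ φ : Fm, Fm.lift g '' (insert φ Γ : Finset Fm) = f '' S ∪ {Fm.lift g φ} := by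
    intro φ
    rw [Finset.coe_insert, Set.image_insert_eq, Set.union_singleton, Finset.coe_image,
      Set.image_image]
    rfl
  have hne : ∀ φ : Fm, (insert φ Γ).Nonempty := fun φ => Finset.insert_nonempty φ Γ
  -- The two premises of the left rule for `⊕`: `false` gives the one with `a`, `true` the one with
  -- `b`.
  let prem : Bool → Sequent := fun i => .single (insert (.var i.toNat) Γ) (hne _) (.var 2)
  have hd : Derivable (Set.range prem) (insert (.kSup (.var 0) (.var 1)) Γ) {.var 2} :=
    .kSup_left _ _ _ _ (.hyp (prem false) ⟨false, rfl⟩) (.hyp (prem true) ⟨true, rfl⟩)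
  have := hG Bool (fun i => insert (Fm.var i.toNat) Γ) (fun _ => hne _) (fun _ => .var 2) _
    (hne (.kSup (.var 0) (.var 1))) (.var 2) hd (Fm.lift g) (by
      rintro (_ | _)
      · rw [hΓ]
        exact ha
      · rw [hΓ]
        exact hb)
  rw [hΓ] at this
  exact this

theorem propPDI (hC : Finitary C) : PropPDI C := by
  intro X a b
  constructor
  · have h : C {tSup a b} = C {kSup a b} := by
      refine hG.closure_eq_of_derivable (φ := .tSup (.var 0) (.var 1))
        (ψ := .kSup (.var 0) (.var 1)) ?_ ?_ (assign a b)
      · exact .tSup_left _ _ _ _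
          (.kSup_right _ _ _ _ (.of_mem (.var 0) (by simp) (by simp)))
          (.kSup_right _ _ _ _ (.of_mem (.var 1) (by simp) (by simp)))
      · exact .kSup_left _ _ _ _
          (.tSup_right _ _ _ _ (.of_mem (.var 0) (by simp) (by simp)))
          (.tSup_right _ _ _ _ (.of_mem (.var 1) (by simp) (by simp)))
    calc C (X ∪ {tSup a b}) = C (X ∪ C {tSup a b}) := (C.closure_sup_closure_right _ _).symm
      _ = C (X ∪ C {kSup a b}) := by rw [h]
      _ = C (X ∪ {kSup a b}) := C.closure_sup_closure_right _ _
  · apply Set.Subset.antisymm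
    · have ha : C {kSup a b} ⊆ C {a} :=
        hG.closure_le_of_derivable (φ := .var 0) (ψ := .kSup (.var 0) (.var 1))
          (.kSup_right _ _ _ _ (.of_mem (.var 0) (by simp) (by simp))) (assign a b)
      have hb : C {kSup a b} ⊆ C {b} :=
        hG.closure_le_of_derivable (φ := .var 1) (ψ := .kSup (.var 0) (.var 1))
          (.kSup_right _ _ _ _ (.of_mem (.var 1) (by simp) (by simp))) (assign a b)
      have key : ∀ x, C {kSup a b} ⊆ C {x} → C (X ∪ {kSup a b}) ⊆ C (X ∪ {x}) := fun x hx =>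
        C.closure_min (Set.union_subset (Set.subset_union_left.trans (C.le_closure _))
          ((C.le_closure _).trans (hx.trans (C.monotone Set.subset_union_right))))
          (C.isClosed_closure _)
      exact Set.subset_inter (key a ha) (key b hb)
    · rintro c ⟨ha, hb⟩
      obtain ⟨Y₁, hY₁, hX₁, hc₁⟩ := hC _ _ ha
      obtain ⟨Y₂, hY₂, hX₂, hc₂⟩ := hC _ _ hb
      -- A common finite context inside `X`. Elements lost by intersecting with `X` can only be `a`
      -- or `b`, which the respective premise restores.
      have hY : ((Y₁ ∪ Y₂) ∩ X).Finite := (hY₁.union hY₂).inter_of_left X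
      refine C.monotone (Set.union_subset_union_left _ Set.inter_subset_right)
        (hG.mem_closure_kSup_of_finite hY (C.monotone ?_ hc₁) (C.monotone ?_ hc₂))
      · intro y hy
        rcases hX₁ hy with h | h
        exacts [Or.inl ⟨Or.inl hy, h⟩, Or.inr h]
      · intro y hy
        rcases hX₂ hy with h | h
        exacts [Or.inl ⟨Or.inr hy, h⟩, Or.inr h]

end IsGentzenModel

theorem isTarskiModel_iff_isGentzenModel {C : ClosureOperator (Set A)} :
    IsTarskiModel C ↔ Finitary C ∧ IsGentzenModel GLB C ∧ C ∅ = ∅ :=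
  ⟨fun h => ⟨h.finitary, h.isGentzenModel, h.propE⟩, fun ⟨hf, hG, hE⟩ =>
    ⟨hf, hE, hG.propPC, hG.propPDI hf, hG.propPDN, hG.propPDM⟩⟩

end LogBilat

theorem theoremt :
    (∀ (A : Type u) [LogBilat.Alg A] (C : ClosureOperator (Set A)),
      LogBilat.IsFullModel LogBilat.LB C ↔
        LogBilat.Finitary C ∧ LogBilat.PropE C ∧ LogBilat.PropPC C ∧ LogBilat.PropPDI C ∧
          LogBilat.PropPDN C ∧ LogBilat.PropPDM C) ∧
    LogBilat.FullyAdequate.{u} LogBilat.GLB LogBilat.LB := by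
  refine ⟨fun A _ C => ?_, fun A _ C => ?_⟩
  · rw [LogBilat.isFullModel_LB_iff]
    exact ⟨fun h => ⟨h.finitary, h.propE, h.propPC, h.propPDI, h.propPDN, h.propPDM⟩,
      fun ⟨h₁, h₂, h₃, h₄, h₅, h₆⟩ => ⟨h₁, h₂, h₃, h₄, h₅, h₆⟩⟩
  · rw [LogBilat.isFullModel_LB_iff, LogBilat.isTarskiModel_iff_isGentzenModel]
    -- As LB has no theorems, the two clauses on theorems reduce to `C ∅ = ∅`.
    simp [LogBilat.not_LB_hasTheorems]
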